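/- For an infinite cardinal $\kappa$, a set $A \subseteq \mathbb{R}$ is called $\kappa$-dense in $\mathbb{R}$ if $|U \cap A| = \kappa$ for every nonempty open set $U \subseteq \mathbb{R}$. Assume Baumgartner's Axiom $\mathsf{BA}(\omega_1)$: every two sets of reals that are $\omega_1$-dense in $\mathbb{R}$ are order isomorphic. Let $K$ and $L$ be separable compact lines, that is, linearly ordered sets that are compact and separable in their order topologies, and suppose that both have weight $\omega_1$ (the weight of a space is the least cardinality of a base of its topology). Then the Banach spaces $C(K)$ and $C(L)$ of real-valued continuous functions with the supremum norm are isomorphic, that is, there is a linear homeomorphism of $C(K)$ onto $C(L)$. -/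

import Mathlib

open scoped Cardinal

/-- The weight of a topological space: the least cardinality of a base of its topology. -/
noncomputable def topologicalWeight (X : Type*) [TopologicalSpace X] : Cardinal :=
  sInf {c | ∃ B : Set (Set X), TopologicalSpace.IsTopologicalBasis B ∧ #B = c}

/-- A subset `A` of a topological space `X` is `κ`-dense in `X` if it meets every nonempty open
subset of `X` in a set of cardinality exactly `κ`. -/
def IsCardinalDense {X : Type*} [TopologicalSpace X] (κ : Cardinal) (A : Set X) : Prop :=
  ∀ U : Set X, IsOpen U → U.Nonempty → #(U ∩ A : Set X) = κ

/-- Baumgartner's Axiom `BA(κ)`: every two sets of reals that are `κ`-dense in `ℝ` are order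
isomorphic. -/
def BaumgartnerAxiom (κ : Cardinal.{0}) : Prop :=
  ∀ A B : Set ℝ, IsCardinalDense κ A → IsCardinalDense κ B → Nonempty (A ≃o B)

/-! The jumps of `K` (points with an immediate successor) carry its weight. Removing all open sets
with only countably many jumps leaves a closed kernel H = `jumpKernel K`. The jumps of H are
ℵ₁-dense in H and order isomorphic to an ℵ₁-dense set A of reals, and H is the line of cuts
`LowerSet A`. A linear extension operator for closed subsets of compact lines gives C(K) ≅ C(H) ⊕ S,
where S consists of the functions vanishing on H. Outside H there are only countably many jumps, so
a map to [0, 1] separates the points there, and S is complemented in C([0, 1]).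

It remains to absorb S into C(`LowerSet A`). Since |A| = ℵ₁ < 𝔠, the product (ω+1) × 2^ω × 2^ω
embeds in ℝ ∖ A and hence in `LowerSet A`. So the convergent sequences in Z = C(2^ω × 2^ω) form a
complemented subspace of C(`LowerSet A`). By an averaging argument in the style of Milyutin, S is
complemented in Z, and shifting the S-components of sequences absorbs one copy of S.

Hence C(K) ≅ C(`LowerSet A`), and likewise C(L) ≅ C(`LowerSet B`). Baumgartner's Axiom enters twice:
it forces ℵ₁ < 𝔠, and it makes A and B, hence their lines of cuts, isomorphic. -/

open Set Filter Topology

/-! ### Complemented subspaces and absorption -/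

/-- `X` is isomorphic to a complemented subspace of `Y`. -/
def IsComplementedIn (X Y : Type*) [NormedAddCommGroup X] [NormedSpace ℝ X]
    [NormedAddCommGroup Y] [NormedSpace ℝ Y] : Prop :=
  ∃ (i : X →L[ℝ] Y) (r : Y →L[ℝ] X), ∀ x, r (i x) = x

theorem IsComplementedIn.trans {X Y Z : Type*} [NormedAddCommGroup X] [NormedSpace ℝ X]
    [NormedAddCommGroup Y] [NormedSpace ℝ Y] [NormedAddCommGroup Z] [NormedSpace ℝ Z]
    (h₁ : IsComplementedIn X Y) (h₂ : IsComplementedIn Y Z) : IsComplementedIn X Z := by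
  obtain ⟨i, r, h⟩ := h₁
  obtain ⟨j, s, h'⟩ := h₂
  exact ⟨j.comp i, r.comp s, fun x => by simp [h, h']⟩

theorem ContinuousLinearEquiv.isComplementedIn {X Y : Type*} [NormedAddCommGroup X]
    [NormedSpace ℝ X] [NormedAddCommGroup Y] [NormedSpace ℝ Y] (e : X ≃L[ℝ] Y) :
    IsComplementedIn X Y :=
  ⟨e, e.symm, fun x => by simp⟩

/-- Composition with a fixed continuous map, as a continuous linear map between spaces of
continuous functions. -/
def pullbackCLM {X Y : Type*} [TopologicalSpace X] [TopologicalSpace Y] (φ : C(X, Y))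
    (E : Type*) [NormedAddCommGroup E] [NormedSpace ℝ E] : C(Y, E) →L[ℝ] C(X, E) where
  toFun f := f.comp φ
  map_add' _ _ := rfl
  map_smul' _ _ := rfl
  cont := ContinuousMap.continuous_precomp φ

@[simp]
theorem pullbackCLM_apply {X Y : Type*} [TopologicalSpace X] [TopologicalSpace Y] (φ : C(X, Y))
    {E : Type*} [NormedAddCommGroup E] [NormedSpace ℝ E] (f : C(Y, E)) (x : X) :
    pullbackCLM φ E f x = f (φ x) := rfl

/-- A homeomorphism induces an isomorphism of spaces of continuous functions. -/
noncomputable def Homeomorph.pullbackEquiv {X Y : Type*} [TopologicalSpace X] [TopologicalSpace Y]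
    (φ : X ≃ₜ Y) : C(Y, ℝ) ≃L[ℝ] C(X, ℝ) :=
  ContinuousLinearEquiv.equivOfInverse (pullbackCLM φ ℝ) (pullbackCLM φ.symm ℝ)
    (fun f => by ext; simp) (fun f => by ext; simp)

/-- Currying as an isomorphism of spaces of continuous functions. -/
noncomputable def curryCLE (X Y : Type*) [TopologicalSpace X] [TopologicalSpace Y] [CompactSpace X]
    [CompactSpace Y] [T2Space X] [T2Space Y] : C(X × Y, ℝ) ≃L[ℝ] C(X, C(Y, ℝ)) where
  toFun f := f.curry
  invFun f := f.uncurry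
  left_inv _ := rfl
  right_inv _ := rfl
  map_add' _ _ := rfl
  map_smul' _ _ := rfl
  continuous_toFun := ContinuousMap.continuous_curry
  continuous_invFun := ContinuousMap.continuous_uncurry

theorem exists_mkNat {Z : Type*} [TopologicalSpace Z] (u : ℕ → Z) (z : Z)
    (h : Tendsto u atTop (𝓝 z)) :
    ∃ v : C(OnePoint ℕ, Z), (∀ n : ℕ, v n = u n) ∧ v OnePoint.infty = z :=
  ⟨OnePoint.continuousMapMkNat u z h, fun _ => rfl, rfl⟩

theorem tendsto_coe_infty {Z : Type*} [TopologicalSpace Z] (v : C(OnePoint ℕ, Z)) :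
    Tendsto (fun n : ℕ => v n) atTop (𝓝 (v OnePoint.infty)) := by
  have := (OnePoint.continuous_iff_from_nat v).1 v.continuous
  exact this

/-- If `S` is complemented in `Z`, then the space of convergent sequences in `Z` absorbs `S`. -/
theorem exists_absorb_seq {S Z : Type*} [NormedAddCommGroup S] [NormedSpace ℝ S] [CompleteSpace S]
    [NormedAddCommGroup Z] [NormedSpace ℝ Z] [CompleteSpace Z] (h : IsComplementedIn S Z) :
    Nonempty (C(OnePoint ℕ, Z) ≃L[ℝ] S × C(OnePoint ℕ, Z)) := by
  obtain ⟨i, r, hir⟩ := h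
  obtain ⟨τ, hτ, hτ'⟩ := exists_mkNat (fun n : ℕ => ((n + 1 : ℕ) : OnePoint ℕ)) OnePoint.infty
    ((tendsto_coe_infty (ContinuousMap.id (OnePoint ℕ))).comp (tendsto_add_atTop_nat 1))
  let P : C(OnePoint ℕ, Z) →L[ℝ] C(OnePoint ℕ, Z) :=
    (i.comp r).compLeftContinuous ℝ (OnePoint ℕ)
  -- `T` outputs the S-component of term 0 and moves the other S-components one place down, leaving
  -- the components in the kernel of `r` fixed. The limit is unchanged.
  let T : C(OnePoint ℕ, Z) →L[ℝ] S × C(OnePoint ℕ, Z) :=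
    (r.comp (ContinuousMap.evalCLM ℝ ((0 : ℕ) : OnePoint ℕ))).prod
      (ContinuousLinearMap.id ℝ _ - P + P.comp (pullbackCLM τ Z))
  have hT1 : ∀ v, (T v).1 = r (v ((0 : ℕ) : OnePoint ℕ)) := fun v => rfl
  have hT2 : ∀ v x, (T v).2 x = v x - i (r (v x)) + i (r (v (τ x))) := fun v x => rfl
  refine ⟨ContinuousLinearEquiv.ofBijective T ?_ ?_⟩
  · rw [LinearMap.ker_eq_bot']
    intro v hv
    have h0 : ∀ n : ℕ, r (v n) = 0 := by
      intro n
      induction n with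
      | zero => rw [← hT1]; rw [show T v = 0 from hv]; rfl
      | succ n ih =>
        have h := hT2 v n
        rw [show T v = 0 from hv, hτ] at h
        have h := congrArg r h
        simp only [map_add, map_sub, hir, sub_self, zero_add] at h
        rw [← h]; simp
    ext x
    induction x using OnePoint.rec with
    | infty =>
      have h := hT2 v OnePoint.infty
      rw [show T v = 0 from hv, hτ'] at h
      simpa using h.symm
    | coe n =>
      have h := hT2 v n
      rw [show T v = 0 from hv, hτ, h0, h0] at h
      simpa using h.symm
  · rw [LinearMap.range_eq_top]
    rintro ⟨s, w⟩
    -- The inverse of `T`: S-components move one place up, and `s` fills the free place.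
    let u : ℕ → Z := fun n => match n with
      | 0 => i s + (w ((0 : ℕ) : OnePoint ℕ) - i (r (w ((0 : ℕ) : OnePoint ℕ))))
      | n + 1 => i (r (w n)) + (w ((n + 1 : ℕ) : OnePoint ℕ) -
          i (r (w ((n + 1 : ℕ) : OnePoint ℕ))))
    have hu : Tendsto u atTop (𝓝 (w OnePoint.infty)) := by
      rw [← tendsto_add_atTop_iff_nat 1]
      have h1 := tendsto_coe_infty w
      have h2 := h1.comp (tendsto_add_atTop_nat 1)
      have hc : Continuous fun z => i (r z) := by fun_prop
      have := ((hc.tendsto _).comp h1).add (h2.sub ((hc.tendsto _).comp h2))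
      simpa using this
    obtain ⟨v, hv, hv'⟩ := exists_mkNat u _ hu
    have hr : ∀ n, r (u (n + 1)) = r (w n) := fun n => by simp [u, hir]
    refine ⟨v, Prod.ext ?_ ?_⟩
    · change (T v).1 = s
      rw [hT1, hv]; simp [u, hir]
    · change (T v).2 = w
      ext x
      rw [hT2]
      induction x using OnePoint.rec with
      | infty => simp [hτ', hv']
      | coe n =>
        rw [hτ, hv, hv, hr]
        cases n with
        | zero => simp [u, hir]
        | succ n => rw [hr]; simp [u]

/-- `V` splits as C(ω+1, Z) plus a complement, and the first summand does the absorbing. -/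
theorem exists_absorb {S Z V : Type*} [NormedAddCommGroup S] [NormedSpace ℝ S] [CompleteSpace S]
    [NormedAddCommGroup Z] [NormedSpace ℝ Z] [CompleteSpace Z]
    [NormedAddCommGroup V] [NormedSpace ℝ V]
    (h : IsComplementedIn S Z) (h' : IsComplementedIn C(OnePoint ℕ, Z) V) :
    Nonempty (V ≃L[ℝ] S × V) := by
  obtain ⟨e⟩ := exists_absorb_seq h
  obtain ⟨i, r, hir⟩ := h'
  let d := ContinuousLinearEquiv.equivOfRightInverse r i hir
  exact ⟨d.trans <| (e.prodCongr (.refl ℝ _)).trans <|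
    (ContinuousLinearEquiv.prodAssoc ℝ S _ _).trans <|
      (ContinuousLinearEquiv.refl ℝ S).prodCongr d.symm⟩

/-! ### Linear extension operators on compact lines -/

/-- Either a gap of `H` lies just to the right of `x`, where `h₂` applies, or `H` accumulates at `x`
from the right. Then `x ∈ H`, and by `h₁` the values of `g` on a short interval with endpoints in
`H` stay as close to `g x` as those on `H`. The left-hand version is the order dual. -/
theorem continuousWithinAt_Ici_of_interpolation {K : Type*} [LinearOrder K] [TopologicalSpace K]
    [OrderTopology K] {H : Set K} (hH : IsClosed H) {g : K → ℝ} (hg : ContinuousOn g H)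
    (h₁ : ∀ a ∈ H, ∀ b ∈ H, ∀ z, a ≤ z → z ≤ b → ∀ c ε : ℝ,
      (∀ h ∈ H, a ≤ h → h ≤ b → |g h - c| < ε) → |g z - c| < ε)
    (h₂ : ∀ a b, a < b → (∀ h ∈ H, a < h → h < b → False) →
      ContinuousOn g {z | a ≤ z ∧ z ≤ b}) (x : K) :
    ContinuousWithinAt g (Ici x) x := by
  by_cases hx : ∃ y, x < y
  swap
  · have : Ici x = {x} := by
      ext y
      simp only [mem_Ici, mem_singleton_iff]
      exact ⟨fun h => (not_lt.1 fun h' => hx ⟨y, h'⟩).antisymm h, fun h => h.ge⟩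
    rw [this]
    exact continuousWithinAt_singleton
  by_cases hB : ∃ y, x < y ∧ ∀ h ∈ H, x < h → h < y → False
  · obtain ⟨y, hxy, hy⟩ := hB
    have := (h₂ x y hxy hy) x ⟨le_rfl, hxy.le⟩
    exact this.mono_of_mem_nhdsWithin (Icc_mem_nhdsGE hxy)
  · push Not at hB
    have hxH : x ∈ H := by
      rw [← hH.closure_eq, mem_closure_iff_nhds]
      intro t ht
      obtain ⟨u, hu, hut⟩ := (mem_nhdsGE_iff_exists_Ico_subset' hx.choose_spec).1
        (mem_nhdsWithin_of_mem_nhds ht)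
      obtain ⟨h, hh, h1, h2, -⟩ := hB u hu
      exact ⟨h, hut ⟨h1.le, h2⟩, hh⟩
    rw [Metric.continuousWithinAt_iff']
    intro ε hε
    have h3 := Metric.continuousWithinAt_iff'.1 (hg x hxH) ε hε
    rw [eventually_nhdsWithin_iff] at h3
    obtain ⟨u, hu, hut⟩ := (mem_nhdsGE_iff_exists_Ico_subset' hx.choose_spec).1
      (mem_nhdsWithin_of_mem_nhds h3)
    obtain ⟨h, hh, h1, h2, -⟩ := hB u hu
    filter_upwards [Icc_mem_nhdsGE h1] with z hz
    rw [Real.dist_eq]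
    refine h₁ x hxH h hh z hz.1 hz.2 _ _ fun h' hh' h3 h4 => ?_
    exact hut ⟨h3, h4.trans_lt h2⟩ hh'

theorem continuous_of_interpolation {K : Type*} [LinearOrder K] [TopologicalSpace K]
    [OrderTopology K] {H : Set K} (hH : IsClosed H) {g : K → ℝ} (hg : ContinuousOn g H)
    (h₁ : ∀ a ∈ H, ∀ b ∈ H, ∀ z, a ≤ z → z ≤ b → ∀ c ε : ℝ,
      (∀ h ∈ H, a ≤ h → h ≤ b → |g h - c| < ε) → |g z - c| < ε)
    (h₂ : ∀ a b, a < b → (∀ h ∈ H, a < h → h < b → False) →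
      ContinuousOn g {z | a ≤ z ∧ z ≤ b}) : Continuous g := by
  rw [continuous_iff_continuousAt]
  intro x
  rw [continuousAt_iff_continuous_left'_right']
  have hr := continuousWithinAt_Ici_of_interpolation hH hg h₁ h₂ x
  have hl : ContinuousWithinAt g (Iic x) x :=
    continuousWithinAt_Ici_of_interpolation (K := Kᵒᵈ) hH hg
      (fun a ha b hb z hz hz' c ε h => h₁ b hb a ha z hz' hz c ε
        fun h' hh' h1 h2 => h h' hh' h2 h1)
      (fun a b hab h => by
        have := h₂ b a hab fun h' hh' h1 h2 => h h' hh' h2 h1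
        exact this.mono fun z hz => ⟨hz.2, hz.1⟩) x
  exact ⟨hl.mono Iio_subset_Iic_self, hr.mono Ioi_subset_Ici_self⟩

/-- A nonempty closed subset of a compact line admits a linear extension operator. -/
theorem IsClosed.exists_extensionCLM {K : Type*} [LinearOrder K] [TopologicalSpace K]
    [OrderTopology K] [CompactSpace K] {H : Set K} (hH : IsClosed H) (hne : H.Nonempty) :
    ∃ E : C(H, ℝ) →L[ℝ] C(K, ℝ), ∀ f (x : H), E f x = f x := by
  have := isCompact_iff_compactSpace.1 hH.isCompact
  obtain ⟨m, hm, hmin⟩ := hH.isCompact.exists_isLeast hne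
  obtain ⟨M, hM, hmax⟩ := hH.isCompact.exists_isGreatest hne
  -- `l z` and `r z` are the neighbours of `z` in `H`. Clamping by `m` and `M` makes both equal to
  -- the nearest end of `H` when `z` lies beyond it.
  have hl : ∀ z, ∃ l, IsGreatest (H ∩ Iic (max z m)) l := fun z =>
    (hH.isCompact.inter_right isClosed_Iic).exists_isGreatest ⟨m, hm, le_max_right _ _⟩
  have hr : ∀ z, ∃ r, IsLeast (H ∩ Ici (min z M)) r := fun z =>
    (hH.isCompact.inter_right isClosed_Ici).exists_isLeast ⟨M, hM, min_le_right _ _⟩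
  choose l hl using hl
  choose r hr using hr
  have hlH : ∀ z, l z ∈ H := fun z => (hl z).1.1
  have hrH : ∀ z, r z ∈ H := fun z => (hr z).1.1
  have hl1 : ∀ z, ∀ h ∈ H, h ≤ z → h ≤ l z := fun z h hh hz =>
    (hl z).2 ⟨hh, hz.trans (le_max_left _ _)⟩
  have hr1 : ∀ z, ∀ h ∈ H, z ≤ h → r z ≤ h := fun z h hh hz =>
    (hr z).2 ⟨hh, (min_le_left _ _).trans hz⟩
  have hl2 : ∀ z, ∀ h ∈ H, z ≤ h → l z ≤ h := fun z h hh hz =>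
    (hl z).1.2.trans (max_le hz (hmin hh))
  have hr2 : ∀ z, ∀ h ∈ H, h ≤ z → h ≤ r z := fun z h hh hz =>
    (le_min hz (hmax hh)).trans (hr z).1.2
  have hlx : ∀ x ∈ H, l x = x := fun x hx =>
    (hl2 x x hx le_rfl).antisymm (hl1 x x hx le_rfl)
  have hrx : ∀ x ∈ H, r x = x := fun x hx =>
    (hr1 x x hx le_rfl).antisymm (hr2 x x hx le_rfl)
  have hu : ∀ a b : K, ∃ u : C(K, ℝ), (a ≠ b → u a = 0 ∧ u b = 1) ∧ ∀ x, u x ∈ Icc (0 : ℝ) 1 := by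
    intro a b
    by_cases hab : a = b
    · exact ⟨0, fun h => (h hab).elim, fun x => by simp⟩
    · obtain ⟨u, h0, h1, h⟩ := exists_continuous_zero_one_of_isClosed
        (isClosed_singleton (x := a)) (isClosed_singleton (x := b)) (by simpa using hab)
      exact ⟨u, fun _ => ⟨h0 rfl, h1 rfl⟩, h⟩
  choose u hu hu01 using hu
  -- Interpolation across each gap. The Urysohn function depends only on the gap's endpoints, so a
  -- single formula holds on the whole gap.
  let g : C(H, ℝ) → K → ℝ := fun f z =>
    (1 - u (l z) (r z) z) * f ⟨l z, hlH z⟩ + u (l z) (r z) z * f ⟨r z, hrH z⟩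
  have hgH : ∀ f (x : H), g f x = f x := by
    rintro f ⟨x, hx⟩
    have : (⟨l x, hlH x⟩ : H) = ⟨x, hx⟩ := Subtype.ext (hlx x hx)
    have h' : (⟨r x, hrH x⟩ : H) = ⟨x, hx⟩ := Subtype.ext (hrx x hx)
    simp only [g, this, h']
    ring
  have hconv : ∀ f z (c ε : ℝ), |f ⟨l z, hlH z⟩ - c| < ε → |f ⟨r z, hrH z⟩ - c| < ε →
      |g f z - c| < ε := by
    intro f z c ε h1 h2
    obtain ⟨h0, h1'⟩ := hu01 (l z) (r z) z
    rw [abs_lt] at *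
    simp only [g]
    generalize u (l z) (r z) z = v at *
    rcases h0.eq_or_lt with rfl | h0
    · constructor <;> linarith
    · have hv : 0 ≤ 1 - v := by linarith
      have e1 := mul_nonneg hv (sub_pos.2 h1.1).le
      have e2 := mul_nonneg hv (sub_pos.2 h1.2).le
      have e3 := mul_pos h0 (sub_pos.2 h2.1)
      have e4 := mul_pos h0 (sub_pos.2 h2.2)
      constructor <;> linarith
  have hcont : ∀ f, Continuous (g f) := by
    intro f
    refine continuous_of_interpolation hH ?_ ?_ ?_
    · rw [continuousOn_iff_continuous_domRestrict]
      convert f.continuous using 1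
      ext x
      exact hgH f x
    · intro a ha b hb z haz hzb c ε h
      have hh := h (l z) (hlH z) (hl1 z a ha haz) (hl2 z b hb hzb)
      have hh' := h (r z) (hrH z) (hr2 z a ha haz) (hr1 z b hb hzb)
      rw [hgH f ⟨_, hlH z⟩] at hh
      rw [hgH f ⟨_, hrH z⟩] at hh'
      exact hconv f z c ε hh hh'
    · intro a b hab hgap
      let g' : K → ℝ := fun z => (1 - u (l a) (r b) z) * f ⟨l a, hlH a⟩ +
        u (l a) (r b) z * f ⟨r b, hrH b⟩
      have hg' : Continuous g' := by fun_prop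
      refine hg'.continuousOn.congr ?_
      rintro z ⟨haz, hzb⟩
      by_cases hz : z ∈ H
      · rw [hgH f ⟨z, hz⟩]
        have : z = a ∨ z = b := by
          by_contra! hne
          exact hgap z hz (lt_of_le_of_ne haz (Ne.symm hne.1)) (lt_of_le_of_ne hzb hne.2)
        rcases this with rfl | rfl
        · have h1 : (⟨l z, hlH z⟩ : H) = ⟨z, hz⟩ := Subtype.ext (hlx z hz)
          simp only [g', h1]
          by_cases h2 : l z = r b
          · have h3 : (⟨r b, hrH b⟩ : H) = ⟨z, hz⟩ := Subtype.ext (h2.symm.trans (hlx z hz))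
            rw [h3]; ring
          · have := (hu _ _ h2).1
            nth_rewrite 2 [hlx z hz] at this
            rw [this]; ring
        · have h1 : (⟨r z, hrH z⟩ : H) = ⟨z, hz⟩ := Subtype.ext (hrx z hz)
          simp only [g', h1]
          by_cases h2 : l a = r z
          · have h3 : (⟨l a, hlH a⟩ : H) = ⟨z, hz⟩ := Subtype.ext (h2.trans (hrx z hz))
            rw [h3]; ring
          · have := (hu _ _ h2).2
            nth_rewrite 2 [hrx z hz] at this
            rw [this]; ring
      · have h1 : l z = l a := by
          apply le_antisymm
          · rcases le_max_iff.1 (hl z).1.2 with h | h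
            · refine hl1 a _ (hlH z) (not_lt.1 fun h' => ?_)
              refine hgap _ (hlH z) h' (lt_of_le_of_ne (h.trans hzb) fun hb => hz ?_)
              have : l z = z := h.antisymm (hzb.trans hb.ge)
              exact this ▸ hlH z
            · exact h.trans (hmin (hlH a))
          · rcases le_max_iff.1 (hl a).1.2 with h | h
            · exact hl1 z _ (hlH a) (h.trans haz)
            · exact h.trans (hmin (hlH z))
        have h2 : r z = r b := by
          apply le_antisymm
          · rcases min_le_iff.1 (hr b).1.2 with h | h
            · exact hr1 z _ (hrH b) (hzb.trans h)
            · exact (hmax (hrH z)).trans h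
          · rcases min_le_iff.1 (hr z).1.2 with h | h
            · refine hr1 b _ (hrH z) (not_lt.1 fun h' => ?_)
              refine hgap _ (hrH z) (lt_of_le_of_ne (haz.trans h) fun hb => hz ?_) h'
              have : r z = z := (hb.ge.trans haz).antisymm h
              exact this ▸ hrH z
            · exact (hmax (hrH b)).trans h
        simp only [g, g', h1, h2]
  have hbound : ∀ f z, |g f z| ≤ 1 * ‖f‖ := by
    intro f z
    refine le_of_forall_pos_lt_add fun ε hε => ?_
    rw [one_mul, ← sub_zero (g f z)]
    refine hconv f z 0 _ ?_ ?_ <;> rw [sub_zero] <;>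
      exact lt_of_le_of_lt (f.norm_coe_le_norm _) (by linarith)
  refine ⟨LinearMap.mkContinuous
    { toFun := fun f => ⟨g f, hcont f⟩
      map_add' := fun f f' => by ext z; simp [g]; ring
      map_smul' := fun c f => by ext z; simp [g]; ring } 1 fun f => ?_, fun f x => hgH f x⟩
  exact (ContinuousMap.norm_le _ (by positivity)).2 fun z => hbound f z

theorem Topology.IsClosedEmbedding.exists_extensionCLM {X K : Type*} [TopologicalSpace X]
    [Nonempty X] [LinearOrder K] [TopologicalSpace K] [OrderTopology K] [CompactSpace K] {e : X → K}
    (he : IsClosedEmbedding e) :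
    ∃ E : C(X, ℝ) →L[ℝ] C(K, ℝ), ∀ f (x : X), E f (e x) = f x := by
  obtain ⟨E, hE⟩ := he.isClosed_range.exists_extensionCLM (range_nonempty e)
  let φ : X ≃ₜ range e := he.isEmbedding.toHomeomorph
  refine ⟨E.comp (pullbackCLM ⟨φ.symm, φ.symm.continuous⟩ ℝ), fun f x => ?_⟩
  have := hE (f.comp ⟨φ.symm, φ.symm.continuous⟩) (φ x)
  have h : (E.comp (pullbackCLM ⟨φ.symm, φ.symm.continuous⟩ ℝ)) f (e x) = f (φ.symm (φ x)) := this
  rw [h, φ.symm_apply_apply]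

theorem Topology.IsClosedEmbedding.isComplementedIn {X K : Type*} [TopologicalSpace X]
    [CompactSpace X] [Nonempty X] [LinearOrder K] [TopologicalSpace K] [OrderTopology K]
    [CompactSpace K] {e : X → K} (he : IsClosedEmbedding e) :
    IsComplementedIn C(X, ℝ) C(K, ℝ) := by
  obtain ⟨E, hE⟩ := he.exists_extensionCLM
  exact ⟨E, pullbackCLM ⟨e, he.continuous⟩ ℝ, fun f => by ext x; exact hE f x⟩

/-! ### Averaging over binary digits -/

theorem Nat.eventually_floor_eq_of_ne {y : ℝ} (hy : 0 ≤ y) (h : ∀ k : ℕ, y ≠ k) :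
    ∀ᶠ z in 𝓝 y, ⌊z⌋₊ = ⌊y⌋₊ := by
  have h1 : (⌊y⌋₊ : ℝ) < y := lt_of_le_of_ne (Nat.floor_le hy) (h _).symm
  filter_upwards [Ioo_mem_nhds h1 (Nat.lt_floor_add_one y)] with z hz
  rw [Nat.floor_eq_iff ((Nat.cast_nonneg _).trans hz.1.le)]
  exact ⟨hz.1.le, hz.2⟩

theorem Real.continuousAt_digits {b : ℕ} [NeZero b] {x : ℝ} (hx : 0 ≤ x)
    (h : ∀ i k : ℕ, x * b ^ (i + 1) ≠ k) : ContinuousAt (fun x => Real.digits x b) x := by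
  refine tendsto_pi_nhds.2 fun i => ?_
  have hc : Tendsto (fun z : ℝ => z * b ^ (i + 1)) (𝓝 x) (𝓝 (x * b ^ (i + 1))) :=
    (continuous_mul_const _).tendsto x
  refine tendsto_const_nhds.congr' ?_
  filter_upwards [hc.eventually (Nat.eventually_floor_eq_of_ne (by positivity) (h i))] with z hz
  simp only [Real.digits, hz]

theorem Real.measurable_digits {b : ℕ} [NeZero b] : Measurable fun x => Real.digits x b :=
  measurable_pi_lambda _ fun _ =>
    (measurable_from_top (f := Fin.ofNat b)).comp (Nat.measurable_floor.comp (by fun_prop))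

open MeasureTheory in
/-- `C([0, 1])` is complemented in the space of continuous functions on a Cantor set. -/
theorem isComplementedIn_cantor :
    IsComplementedIn C(Icc (0 : ℝ) 1, ℝ) C((ℕ → Fin 2) × (ℕ → Fin 2), ℝ) := by
  let μ : Measure ℝ := volume.restrict (Ioo 0 1)
  have hμ : IsProbabilityMeasure μ := ⟨by simp [μ]⟩
  -- The digits of `t` itself jump at dyadic `t`. Coding `t` by a random `s` and the midpoint `(s +
  -- t) / 2` makes a jump at a given `t` a null event, so averages over `s` are continuous in `t`.
  let D : ℝ → ℝ → (ℕ → Fin 2) × (ℕ → Fin 2) := fun t s =>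
    (Real.digits s 2, Real.digits ((s + t) / 2) 2)
  have hD : ∀ t, Measurable (D t) := fun t =>
    Real.measurable_digits.prodMk (Real.measurable_digits.comp (by fun_prop))
  have hmeas : ∀ (f : C((ℕ → Fin 2) × (ℕ → Fin 2), ℝ)) t,
      AEStronglyMeasurable (fun s => f (D t s)) μ := fun f t =>
    (f.continuous.measurable.comp (hD t)).aestronglyMeasurable
  have hint : ∀ (f : C((ℕ → Fin 2) × (ℕ → Fin 2), ℝ)) t, Integrable (fun s => f (D t s)) μ :=
    fun f t => Integrable.of_bound (hmeas f t) ‖f‖ (.of_forall fun s => f.norm_coe_le_norm _)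
  have hcont : ∀ f : C((ℕ → Fin 2) × (ℕ → Fin 2), ℝ),
      Continuous fun t : Icc (0 : ℝ) 1 => ∫ s, f (D t s) ∂μ := by
    intro f
    rw [continuous_iff_continuousAt]
    intro t
    refine continuousAt_of_dominated (bound := fun _ => ‖f‖) (.of_forall fun t => hmeas f t)
      (.of_forall fun t => .of_forall fun s => f.norm_coe_le_norm _) (integrable_const _) ?_
    have hbad : (range fun p : ℕ × ℕ => 2 * p.2 / (2 : ℝ) ^ (p.1 + 1) - t).Countable :=
      countable_range _
    filter_upwards [ae_restrict_mem measurableSet_Ioo,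
      ae_restrict_of_ae (hbad.ae_notMem volume)] with s hs hs'
    have h1 : ContinuousAt (fun x => Real.digits x 2) ((s + t) / 2) := by
      refine Real.continuousAt_digits (by linarith [hs.1, t.2.1]) fun i k hk => hs' ⟨(i, k), ?_⟩
      have : (2 : ℝ) ^ (i + 1) ≠ 0 := by positivity
      push_cast at hk
      simp only [← hk]
      field_simp
      ring
    have h2 : ContinuousAt (fun t' : Icc (0 : ℝ) 1 => Real.digits ((s + t') / 2) 2) t :=
      ContinuousAt.comp (g := fun x => Real.digits x 2)
        (f := fun t' : Icc (0 : ℝ) 1 => (s + t') / 2) h1 (by fun_prop)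
    exact f.continuous.continuousAt.comp (continuousAt_const.prodMk h2)
  let r : C((ℕ → Fin 2) × (ℕ → Fin 2), ℝ) →L[ℝ] C(Icc (0 : ℝ) 1, ℝ) := LinearMap.mkContinuous
    { toFun := fun f => ⟨fun t => ∫ s, f (D t s) ∂μ, hcont f⟩
      map_add' := fun f g => by
        ext t
        exact integral_add (hint f t) (hint g t)
      map_smul' := fun c f => by
        ext t
        exact integral_const_mul c _ } 1 fun f => by
    refine (ContinuousMap.norm_le _ (by positivity)).2 fun t => ?_
    have := norm_integral_le_of_norm_le_const (μ := μ) (f := fun s => f (D t s)) (C := ‖f‖)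
      (.of_forall fun s => f.norm_coe_le_norm _)
    simpa using this
  -- Decoding is t = 2 · midpoint − s. The clamp only matters for pairs that code no `t`.
  let ψ : C((ℕ → Fin 2) × (ℕ → Fin 2), Icc (0 : ℝ) 1) :=
    ⟨fun p => projIcc 0 1 zero_le_one (2 * Real.ofDigits p.2 - Real.ofDigits p.1),
      continuous_projIcc.comp (((Real.continuous_ofDigits.comp continuous_snd).const_mul 2).sub
        (Real.continuous_ofDigits.comp continuous_fst))⟩
  refine ⟨pullbackCLM ψ ℝ, r, fun g => ?_⟩
  ext t
  change ∫ s, g (ψ (D t s)) ∂μ = g t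
  have : ∀ᵐ s ∂μ, g (ψ (D t s)) = g t := by
    filter_upwards [ae_restrict_mem measurableSet_Ioo] with s hs
    congr 1
    have h1 : Real.ofDigits (Real.digits s 2) = s :=
      Real.ofDigits_digits one_lt_two ⟨hs.1.le, hs.2⟩
    have h2 : Real.ofDigits (Real.digits ((s + t) / 2) 2) = (s + t) / 2 :=
      Real.ofDigits_digits one_lt_two
        ⟨by linarith [hs.1, t.2.1], by linarith [hs.2, t.2.2]⟩
    simp only [ψ, D, ContinuousMap.coe_mk, h1, h2]
    rw [show 2 * ((s + (t : ℝ)) / 2) - s = t by ring, projIcc_val]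
  rw [integral_congr_ae this]
  simp

/-! ### Compact sets avoiding a small set of reals -/

theorem exists_continuous_injective_cantor_prod :
    ∃ f : (ℕ → Bool) × (ℕ → Bool) → ℕ → Bool, Continuous f ∧ Function.Injective f := by
  refine ⟨fun p k => if k % 2 = 0 then p.1 (k / 2) else p.2 (k / 2), ?_, ?_⟩
  · refine continuous_pi fun k => ?_
    split_ifs <;> fun_prop
  · rintro ⟨x, y⟩ ⟨x', y'⟩ h
    refine Prod.ext (funext fun m => ?_) (funext fun m => ?_)
    · simpa using congrFun h (2 * m)
    · have := congrFun h (2 * m + 1)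
      simpa [Nat.add_mod, show (2 * m + 1) / 2 = m by omega] using this

theorem exists_continuous_injective_onePoint :
    ∃ f : OnePoint ℕ → ℕ → Bool, Continuous f ∧ Function.Injective f := by
  obtain ⟨v, hv, hv'⟩ := exists_mkNat (fun n : ℕ => (fun k => decide (k = n) : ℕ → Bool))
    (fun _ => false) (tendsto_pi_nhds.2 fun k => by
      refine tendsto_const_nhds.congr' ?_
      filter_upwards [eventually_gt_atTop k] with n hn
      simp [hn.ne])
  refine ⟨v, v.continuous, fun x y hxy => ?_⟩
  induction x using OnePoint.rec with
  | infty =>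
    induction y using OnePoint.rec with
    | infty => rfl
    | coe n =>
      rw [hv', hv] at hxy
      simpa using congrFun hxy n
  | coe m =>
    induction y using OnePoint.rec with
    | infty =>
      rw [hv', hv] at hxy
      simpa using congrFun hxy m
    | coe n =>
      rw [hv, hv] at hxy
      have : m = n := by simpa using congrFun hxy m
      rw [this]

/-- A set of fewer than continuum many reals misses a copy of the product of a convergent sequence
with two Cantor sets. -/
theorem exists_continuous_injective_avoiding {A : Set ℝ} (hA : #A < 𝔠) :
    ∃ f : OnePoint ℕ × (ℕ → Fin 2) × (ℕ → Fin 2) → ℝ, Continuous f ∧ Function.Injective f ∧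
      ∀ x, f x ∉ A := by
  obtain ⟨f, hf, hf'⟩ := exists_continuous_injective_cantor_prod
  obtain ⟨g, hg, hg'⟩ := exists_continuous_injective_onePoint
  obtain ⟨j, -, hj, hj'⟩ := isClosed_univ.exists_nat_bool_injection_of_not_countable
    (α := ℝ) Cardinal.not_countable_real
  let c : (ℕ → Fin 2) → ℕ → Bool := fun x n => finTwoEquiv (x n)
  have hc : Continuous c := continuous_pi fun n =>
    (continuous_of_discreteTopology (f := finTwoEquiv)).comp (continuous_apply n)
  have hc' : Function.Injective c := fun x y h => funext fun n =>
    finTwoEquiv.injective (congrFun h n)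
  -- Continuum many pairwise disjoint copies, indexed by `y`. If each met `A`, then `A` would have
  -- at least 𝔠 points.
  let F : (ℕ → Bool) → OnePoint ℕ × (ℕ → Fin 2) × (ℕ → Fin 2) → ℝ := fun y x =>
    j (f (y, f (g x.1, f (c x.2.1, c x.2.2))))
  have hF : ∀ y, Continuous (F y) := fun y => by fun_prop
  have hinj : ∀ y x y' x', F y x = F y' x' → y = y' ∧ x = x' := by
    rintro y ⟨x1, x2, x3⟩ y' ⟨x1', x2', x3'⟩ h
    obtain ⟨h1, h2⟩ := Prod.ext_iff.1 (hf' (hj' h))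
    obtain ⟨h3, h4⟩ := Prod.ext_iff.1 (hf' h2)
    obtain ⟨h5, h6⟩ := Prod.ext_iff.1 (hf' h4)
    simp only at h1 h3 h5 h6
    rw [h1, hg' h3, hc' h5, hc' h6]
    exact ⟨rfl, rfl⟩
  by_contra! hcon
  have h : ∀ y, ∃ x, F y x ∈ A := fun y => hcon (F y) (hF y) fun x x' h => (hinj _ _ _ _ h).2
  choose x hx using h
  refine hA.not_ge ?_
  have : #(ℕ → Bool) ≤ #A := Cardinal.mk_le_of_injective (f := fun y => (⟨F y (x y), hx y⟩ : A))
    fun y y' h => (hinj _ _ _ _ (Subtype.ext_iff.1 h)).1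
  simpa using this

/-! ### Baumgartner's Axiom and the continuum -/

/-- The negative half of ℝ ∖ {0} is bounded but has no supremum there, whereas ℝ is complete. -/
theorem isEmpty_orderIso_univ_compl_singleton :
    IsEmpty ((univ : Set ℝ) ≃o ({0}ᶜ : Set ℝ)) := by
  refine ⟨fun e => ?_⟩
  let g : ℝ → ℝ := fun x => e ⟨x, trivial⟩
  have hg : ∀ x y, g x < g y ↔ x < y := fun x y => by
    change e ⟨x, trivial⟩ < e ⟨y, trivial⟩ ↔ x < y
    rw [e.lt_iff_lt]
    rfl
  have hg0 : ∀ x, g x ≠ 0 := fun x => (e ⟨x, trivial⟩).2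
  have hsurj : ∀ y, y ≠ 0 → ∃ x, g x = y := fun y hy =>
    ⟨e.symm ⟨y, hy⟩, congrArg Subtype.val (e.apply_symm_apply ⟨y, hy⟩)⟩
  obtain ⟨a, ha⟩ := hsurj (-1) (by norm_num)
  obtain ⟨b, hb⟩ := hsurj 1 (by norm_num)
  have hlub : IsLUB {x | g x < 0} (sSup {x | g x < 0}) :=
    isLUB_csSup ⟨a, by simp [ha]⟩ ⟨b, fun x hx => by
      refine ((hg _ _).1 ?_).le
      rw [hb]
      exact lt_trans hx one_pos⟩
  set s := sSup {x | g x < 0}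
  obtain ⟨m, hm⟩ := hsurj (g s / 2) (by simpa using hg0 s)
  rcases lt_or_gt_of_ne (hg0 s) with h | h
  · have h1 : s < m := (hg _ _).1 (by linarith)
    exact h1.not_ge (hlub.1 (show g m < 0 by linarith))
  · have h1 : m < s := (hg _ _).1 (by linarith)
    refine h1.not_ge (hlub.2 fun x hx => ((hg _ _).1 ?_).le)
    have : g x < 0 := hx
    linarith

/-- If ℵ₁ = 𝔠, then ℝ and ℝ ∖ {0} are both ℵ₁-dense, yet not isomorphic. -/
theorem BaumgartnerAxiom.aleph_one_lt_continuum (h : BaumgartnerAxiom ℵ₁) :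
    (ℵ₁ : Cardinal.{0}) < 𝔠 := by
  refine lt_of_le_of_ne Cardinal.aleph_one_le_continuum fun hc => ?_
  have hU : ∀ U : Set ℝ, IsOpen U → U.Nonempty → #U = (ℵ₁ : Cardinal.{0}) := fun U hU hne => by
    rw [hc, cardinal_eq_of_isOpen ℝ hU hne, Cardinal.mk_real]
  obtain ⟨e⟩ := h univ {0}ᶜ (fun U hO hne => by rw [inter_univ, hU U hO hne])
    (fun U hO hne => hU _ (hO.inter isOpen_compl_singleton) <| by
      have := (dense_compl_singleton (0 : ℝ)).inter_open_nonempty U hO hne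
      exact this)
  exact isEmpty_orderIso_univ_compl_singleton.false e

/-! ### Lines of cuts -/

/-- The line of cuts of a linear order carries the order topology. -/
instance LowerSet.instTopologicalSpaceOfLinearOrder {α : Type*} [LinearOrder α] :
    TopologicalSpace (LowerSet α) := Preorder.topology _

instance LowerSet.instOrderTopologyOfLinearOrder {α : Type*} [LinearOrder α] :
    OrderTopology (LowerSet α) := ⟨rfl⟩

/-- A real `y` determines the cut of all `a < y`. Density of `A` makes this injective. Continuity
needs `f` to avoid `A`, so that `f x ≤ a` is the open condition `f x < a`. By compactness this is a
closed embedding, and the extension operator applies. -/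
theorem isComplementedIn_lowerSet_of_injective {X : Type*} [TopologicalSpace X] [CompactSpace X]
    [Nonempty X] {A : Set ℝ} (hA : Dense A) {f : X → ℝ} (hf : Continuous f)
    (hf' : Function.Injective f) (hfA : ∀ x, f x ∉ A) :
    IsComplementedIn C(X, ℝ) C(LowerSet A, ℝ) := by
  let e : X → LowerSet A := fun x => ⟨{a | (a : ℝ) < f x}, fun a b hba ha =>
    lt_of_le_of_lt (show (b : ℝ) ≤ a from hba) ha⟩
  have he' : Function.Injective e := by
    have key : ∀ x y, f x < f y → e x ≠ e y := fun x y hxy h => by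
      obtain ⟨a, ha, h1, h2⟩ := hA.exists_between hxy
      have : (⟨a, ha⟩ : A) ∈ e x := by rw [h]; exact h2
      exact lt_asymm h1 this
    intro x y h
    by_contra hne
    rcases lt_or_gt_of_ne (hf'.ne hne) with h' | h'
    · exact key _ _ h' h
    · exact key _ _ h' h.symm
  have he : Continuous e := by
    refine OrderTopology.continuous_iff.2 fun Λ => ⟨?_, ?_⟩
    · have : e ⁻¹' Ioi Λ = ⋃ a ∈ {a : A | a ∉ Λ}, {x | (a : ℝ) < f x} := by
        ext x
        simp only [mem_preimage, mem_Ioi, mem_ofPred_eq, mem_iUnion, exists_prop]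
        rw [← not_le, ← LowerSet.coe_subset_coe, not_subset]
        exact ⟨fun ⟨a, h1, h2⟩ => ⟨a, h2, h1⟩, fun ⟨a, h1, h2⟩ => ⟨a, h2, h1⟩⟩
      rw [this]
      exact isOpen_biUnion fun a _ => isOpen_lt continuous_const hf
    · have : e ⁻¹' Iio Λ = ⋃ a ∈ {a : A | a ∈ Λ}, {x | f x < a} := by
        ext x
        simp only [mem_preimage, mem_Iio, mem_ofPred_eq, mem_iUnion, exists_prop]
        rw [← not_le, ← LowerSet.coe_subset_coe, not_subset]
        refine exists_congr fun a => and_congr Iff.rfl ?_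
        change ¬ (a : ℝ) < f x ↔ _
        rw [not_lt]
        exact ⟨fun h => lt_of_le_of_ne h fun h' => hfA x (h' ▸ a.2), le_of_lt⟩
      rw [this]
      exact isOpen_biUnion fun a _ => isOpen_lt hf continuous_const
  exact (he.isClosedEmbedding he').isComplementedIn

theorem IsCardinalDense.mk_eq {κ : Cardinal} {X : Type*} [TopologicalSpace X] [Nonempty X]
    {A : Set X} (hA : IsCardinalDense κ A) : #A = κ := by
  have := hA univ isOpen_univ univ_nonempty
  rwa [univ_inter] at this

theorem IsCardinalDense.dense {κ : Cardinal} (hκ : κ ≠ 0) {X : Type*} [TopologicalSpace X]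
    {A : Set X} (hA : IsCardinalDense κ A) : Dense A := by
  refine dense_iff_inter_open.2 fun U hU hne => ?_
  rw [← nonempty_coe_sort, ← Cardinal.mk_ne_zero_iff, hA U hU hne]
  exact hκ

/-- Spaces complemented in `C([0, 1])` are absorbed by the space of continuous functions on a line
of cuts of an `ℵ₁`-dense set of reals. -/
theorem exists_absorb_lowerSet (h𝔠 : (ℵ₁ : Cardinal.{0}) < 𝔠) {A : Set ℝ}
    (hA : IsCardinalDense ℵ₁ A)
    {S : Type*} [NormedAddCommGroup S] [NormedSpace ℝ S] [CompleteSpace S]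
    (hS : IsComplementedIn S C(Icc (0 : ℝ) 1, ℝ)) :
    Nonempty (C(LowerSet A, ℝ) ≃L[ℝ] S × C(LowerSet A, ℝ)) := by
  -- The absorption is applied with Z = C(2^ω × 2^ω). Currying turns C(ω+1, Z) into functions on the
  -- domain of `f`.
  obtain ⟨f, hf, hf', hfA⟩ := exists_continuous_injective_avoiding (hA.mk_eq.trans_lt h𝔠)
  refine exists_absorb (hS.trans isComplementedIn_cantor) ?_
  exact (curryCLE _ _).symm.isComplementedIn.trans
    (isComplementedIn_lowerSet_of_injective (hA.dense (Cardinal.aleph_pos 1).ne') hf hf' hfA)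

/-! ### Jumps and weight -/

/-- The left endpoints of the jumps of a linear order. -/
def jumps (K : Type*) [LinearOrder K] : Set K := {x | ∃ y, x ⋖ y}

theorem TopologicalSpace.eq_of_le_of_compactSpace_of_t2Space {X : Type*}
    {t₁ t₂ : TopologicalSpace X} (hle : t₁ ≤ t₂) (h₁ : @CompactSpace X t₁) (h₂ : @T2Space X t₂) :
    t₁ = t₂ := by
  refine le_antisymm hle fun s hs => ?_
  have hc := @Continuous.isClosedMap X X t₁ t₂ h₁ h₂ id (continuous_id_iff_le.2 hle) sᶜ
    (@isClosed_compl_iff X t₁ s |>.2 hs)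
  rw [image_id] at hc
  exact @isClosed_compl_iff X t₂ s |>.1 hc

/-- The subspace topology refines the order topology. The former is compact and the latter
Hausdorff, so they agree. -/
theorem orderTopology_of_isClosed {K : Type*} [LinearOrder K] [TopologicalSpace K]
    [OrderTopology K] [CompactSpace K] {H : Set K} (hH : IsClosed H) : OrderTopology H := by
  have hle : instTopologicalSpaceSubtype ≤ Preorder.topology H :=
    induced_topology_le_preorder Iff.rfl
  refine ⟨TopologicalSpace.eq_of_le_of_compactSpace_of_t2Space hle
    (isCompact_iff_compactSpace.1 hH.isCompact) ?_⟩
  let t := Preorder.topology H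
  have ht : @OrderTopology H t _ := @OrderTopology.mk H t _ rfl
  exact @OrderClosedTopology.to_t2Space H t _ (@OrderTopology.to_orderClosedTopology H t _ ht)

theorem exists_isTopologicalBasis_mk_eq (X : Type*) [TopologicalSpace X] :
    ∃ B : Set (Set X), TopologicalSpace.IsTopologicalBasis B ∧ #B = topologicalWeight X :=
  csInf_mem (s := {c | ∃ B : Set (Set X), TopologicalSpace.IsTopologicalBasis B ∧ #B = c})
    ⟨_, _, TopologicalSpace.isTopologicalBasis_opens, rfl⟩

/-- For a jump from `x` to `y` in `H`, a basic set with `x` in it and contained in `Iio y` has `x`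
as its greatest point in `H`, so it determines `x`. -/
theorem mk_jumps_le_weight {K : Type*} [LinearOrder K] [TopologicalSpace K] [OrderTopology K]
    (H : Set K) : #(jumps H) ≤ topologicalWeight K := by
  obtain ⟨B, hB, hcard⟩ := exists_isTopologicalBasis_mk_eq K
  rw [← hcard]
  have h : ∀ x : jumps H, ∃ t : B, ((x : H) : K) ∈ (t : Set K) ∧
      ∀ z : H, (z : K) ∈ (t : Set K) → z ≤ x := by
    rintro ⟨x, y, hxy⟩
    obtain ⟨t, ht, hxt, hty⟩ := hB.exists_subset_of_mem_open
      (show (x : K) ∈ Iio (y : K) from hxy.lt) isOpen_Iio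
    exact ⟨⟨t, ht⟩, hxt, fun z hz => not_lt.1 fun hxz => hxy.2 hxz (hty hz)⟩
  choose t ht ht' using h
  refine Cardinal.mk_le_of_injective (f := t) fun x y hxy => ?_
  exact Subtype.ext ((ht' y x (hxy ▸ ht x)).antisymm (ht' x y (hxy ▸ ht y)))

/-- The rays whose endpoints lie in a countable dense set or bound a jump already generate the
topology. -/
theorem weight_le_aleph0_of_countable_jumps {K : Type*} [LinearOrder K] [TopologicalSpace K]
    [OrderTopology K] [TopologicalSpace.SeparableSpace K] (h : (jumps K).Countable) :
    topologicalWeight K ≤ ℵ₀ := by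
  obtain ⟨D, hD, hD'⟩ := TopologicalSpace.exists_countable_dense K
  have hsucc : ∀ x : jumps K, ∃ y, (x : K) ⋖ y := fun x => x.2
  choose s hs using hsucc
  have := h.to_subtype
  let E : Set K := D ∪ jumps K ∪ range s
  have hE : E.Countable := (hD.union h).union (countable_range s)
  have : SecondCountableTopology K := by
    refine ⟨(Ioi '' E) ∪ (Iio '' E), (hE.image _).union (hE.image _), le_antisymm ?_ ?_⟩
    · refine le_generateFrom ?_
      rintro _ (⟨a, -, rfl⟩ | ⟨a, -, rfl⟩)
      exacts [isOpen_Ioi, isOpen_Iio]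
    · rw [OrderTopology.topology_eq_generate_intervals (α := K)]
      have key : ∀ (S : K → Set K) (a : K), (∀ x ∈ S a, ∃ e ∈ E, x ∈ S e ∧ S e ⊆ S a) →
          (∀ e ∈ E, S e ∈ (Ioi '' E) ∪ (Iio '' E)) →
          IsOpen[TopologicalSpace.generateFrom ((Ioi '' E) ∪ (Iio '' E))] (S a) := by
        intro S a h1 h2
        have : S a = ⋃₀ {t | ∃ e ∈ E, t = S e ∧ S e ⊆ S a} := by
          ext x
          constructor
          · intro hx
            obtain ⟨e, he, h3, h4⟩ := h1 x hx
            exact ⟨_, ⟨e, he, rfl, h4⟩, h3⟩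
          · rintro ⟨_, ⟨e, he, rfl, h4⟩, h3⟩
            exact h4 h3
        rw [this]
        refine TopologicalSpace.GenerateOpen.sUnion _ ?_
        rintro _ ⟨e, he, rfl, -⟩
        exact TopologicalSpace.GenerateOpen.basic _ (h2 e he)
      refine le_generateFrom ?_
      rintro _ ⟨a, rfl | rfl⟩
      · refine key Ioi a (fun x hx => ?_) fun e he => .inl ⟨e, he, rfl⟩
        by_cases hne : (Ioo a x).Nonempty
        · obtain ⟨d, hd, hdD⟩ := hD'.inter_open_nonempty _ isOpen_Ioo hne
          exact ⟨d, .inl (.inl hdD), hd.2, Ioi_subset_Ioi hd.1.le⟩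
        · exact ⟨a, .inl (.inr ⟨x, hx, fun z h1 h2 => hne ⟨z, h1, h2⟩⟩), hx, subset_rfl⟩
      · refine key Iio a (fun x hx => ?_) fun e he => .inr ⟨e, he, rfl⟩
        by_cases hne : (Ioo x a).Nonempty
        · obtain ⟨d, hd, hdD⟩ := hD'.inter_open_nonempty _ isOpen_Ioo hne
          exact ⟨d, .inl (.inl hdD), hd.1, Iio_subset_Iio hd.2.le⟩
        · have hxa : x ⋖ a := ⟨hx, fun z h1 h2 => hne ⟨z, h1, h2⟩⟩
          exact ⟨a, .inr ⟨⟨x, a, hxa⟩, (hs _).unique_right hxa⟩, hx, subset_rfl⟩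
  obtain ⟨b, hb, -, hb'⟩ := TopologicalSpace.exists_countable_basis K
  have hle : topologicalWeight K ≤ #b := csInf_le' ⟨b, hb', rfl⟩
  exact hle.trans (Cardinal.le_aleph0_iff_set_countable.2 hb)

/-- The set `T` either has a greatest element or is exhausted by the intervals from `d` to points of
`D ∩ T`. -/
theorem countable_inter_of_countable_inter_Icc {K : Type*} [LinearOrder K] [TopologicalSpace K]
    [OrderTopology K] [TopologicalSpace.SeparableSpace K] (J : Set K) (d : K) :
    (J ∩ {y | d ≤ y ∧ (J ∩ {z | d ≤ z ∧ z ≤ y}).Countable}).Countable := by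
  obtain ⟨D, hD, hD'⟩ := TopologicalSpace.exists_countable_dense K
  set T := {y | d ≤ y ∧ (J ∩ {z | d ≤ z ∧ z ≤ y}).Countable}
  by_cases hmax : ∃ m ∈ T, ∀ y ∈ T, y ≤ m
  · obtain ⟨m, hm, hm'⟩ := hmax
    refine hm.2.mono ?_
    rintro y ⟨hyJ, hyT⟩
    exact ⟨hyJ, hyT.1, hm' y hyT⟩
  · push Not at hmax
    have : J ∩ T ⊆ ⋃ e ∈ D ∩ T, J ∩ {z | d ≤ z ∧ z ≤ e} := by
      rintro y ⟨hyJ, hyT⟩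
      obtain ⟨y', hy', hyy'⟩ := hmax y hyT
      -- The second step up makes `Ioo y y''` nonempty, so that it meets `D`.
      obtain ⟨y'', hy'', hyy''⟩ := hmax y' hy'
      obtain ⟨e, he, heD⟩ := hD'.inter_open_nonempty _ isOpen_Ioo ⟨y', hyy', hyy''⟩
      have heT : e ∈ T := by
        refine ⟨hyT.1.trans he.1.le, hy''.2.mono ?_⟩
        rintro z ⟨hzJ, hz⟩
        exact ⟨hzJ, hz.1, hz.2.trans he.2.le⟩
      simp only [mem_iUnion]
      exact ⟨e, ⟨heD, heT⟩, hyJ, hyT.1, he.1.le⟩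
    exact ((hD.mono inter_subset_left).biUnion fun e he => he.2.2).mono this

/-! ### The jump kernel -/

/-- The points all of whose neighbourhoods contain uncountably many jumps. -/
def jumpKernel (K : Type*) [LinearOrder K] [TopologicalSpace K] : Set K :=
  {x | ∀ O, IsOpen O → x ∈ O → ¬ (jumps K ∩ O).Countable}

theorem isClosed_jumpKernel (K : Type*) [LinearOrder K] [TopologicalSpace K] :
    IsClosed (jumpKernel K) := by
  rw [← isOpen_compl_iff, isOpen_iff_forall_mem_open]
  intro x hx
  simp only [jumpKernel, mem_compl_iff, mem_ofPred_eq] at hx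
  push Not at hx
  obtain ⟨O, hO, hxO, hc⟩ := hx
  exact ⟨O, fun y hy h => h O hO hy hc, hO, hxO⟩

/-- Outside the jump kernel there are only countably many jumps. -/
theorem exists_compl_jumpKernel_subset (K : Type*) [LinearOrder K] [TopologicalSpace K]
    [OrderTopology K] [TopologicalSpace.SeparableSpace K] :
    ∃ V : Set K, (jumpKernel K)ᶜ ⊆ V ∧ (jumps K ∩ V).Countable ∧
      ∀ x y, x ⋖ y → (x ∈ V ↔ y ∈ V) := by
  obtain ⟨D, hD, hD'⟩ := TopologicalSpace.exists_countable_dense K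
  -- Being joined to some `d ∈ D` through only countably many jumps is unaffected by crossing one
  -- jump. The complement of the kernel need not have this stability.
  refine ⟨⋃ d ∈ D, {y | (jumps K ∩ uIcc d y).Countable}, ?_, ?_, ?_⟩
  · intro x hx
    simp only [jumpKernel, mem_compl_iff, mem_ofPred_eq] at hx
    push Not at hx
    obtain ⟨O, hO, hxO, hc⟩ := hx
    obtain ⟨d, hd, hdD⟩ := mem_closure_iff_nhds.1 (hD' x) _
      (ordConnectedComponent_mem_nhds.2 (hO.mem_nhds hxO))
    simp only [mem_iUnion]
    refine ⟨d, hdD, hc.mono ?_⟩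
    rintro z ⟨hzJ, hz⟩
    rw [uIcc_comm] at hz
    exact ⟨hzJ, hd hz⟩
  · rw [inter_iUnion₂]
    refine hD.biUnion fun d _ => ?_
    have h1 := countable_inter_of_countable_inter_Icc (jumps K) d
    have h2 := countable_inter_of_countable_inter_Icc (K := Kᵒᵈ) (jumps K) d
    refine (h1.union h2).mono ?_
    rintro y ⟨hyJ, hy⟩
    rcases le_total d y with h | h
    · refine .inl ⟨hyJ, h, ?_⟩
      rw [mem_ofPred_eq, uIcc_of_le h] at hy
      exact hy
    · refine .inr ⟨hyJ, h, ?_⟩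
      rw [mem_ofPred_eq, uIcc_of_ge h] at hy
      refine hy.mono ?_
      rintro z ⟨hzJ, hz⟩
      exact ⟨hzJ, hz.2, hz.1⟩
  · intro x y hxy
    simp only [mem_iUnion, exists_prop, mem_ofPred_eq]
    refine exists_congr fun d => and_congr Iff.rfl ⟨fun h => ?_, fun h => ?_⟩
    · refine (h.union (countable_singleton y)).mono ?_
      rintro z ⟨hz, hz'⟩
      by_cases hzy : z = y
      · exact .inr hzy
      · refine .inl ⟨hz, ?_⟩
        have := hxy.1
        have := @hxy.2 z
        simp only [mem_uIcc] at *
        grind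
    · refine (h.union (countable_singleton x)).mono ?_
      rintro z ⟨hz, hz'⟩
      by_cases hzy : z = x
      · exact .inr hzy
      · refine .inl ⟨hz, ?_⟩
        have := hxy.1
        have := @hxy.2 z
        simp only [mem_uIcc] at *
        grind

/-- A jump of `K` from a kernel point `z` to `y` stays a jump in the kernel, from `z` to the least
kernel point above `y`, unless `z` is the maximum. So only countably many jumps of `K` are lost. -/
theorem not_countable_inter_jumps_jumpKernel {K : Type*} [LinearOrder K] [TopologicalSpace K]
    [OrderTopology K] [CompactSpace K] [TopologicalSpace.SeparableSpace K]
    {U : Set (jumpKernel K)} (hU : IsOpen U) (hne : U.Nonempty) :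
    ¬ (U ∩ jumps (jumpKernel K)).Countable := by
  intro hcount
  obtain ⟨V, hV, hVc, -⟩ := exists_compl_jumpKernel_subset K
  obtain ⟨O, hO, rfl⟩ := hU
  obtain ⟨x, hx⟩ := hne
  obtain ⟨M, hM, hM'⟩ := (isClosed_jumpKernel K).isCompact.exists_isGreatest ⟨x, x.2⟩
  refine x.2 O hO hx ?_
  refine (((hcount.image Subtype.val).union hVc).union (countable_singleton M)).mono ?_
  rintro z ⟨hzJ, hzO⟩
  by_cases hzV : z ∈ V
  · exact .inl (.inr ⟨hzJ, hzV⟩)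
  have hzH : z ∈ jumpKernel K := by
    by_contra h
    exact hzV (hV h)
  rcases (hM' hzH).eq_or_lt with h | h
  · exact .inr h
  · refine .inl (.inl ⟨⟨z, hzH⟩, ⟨hzO, ?_⟩, rfl⟩)
    obtain ⟨y, hzy⟩ := hzJ
    obtain ⟨m, hm, hm'⟩ := ((isClosed_jumpKernel K).inter isClosed_Ici).isCompact.exists_isLeast
      ⟨M, hM, show y ≤ M from hzy.ge_of_gt h⟩
    refine ⟨⟨m, hm.1⟩, hzy.lt.trans_le hm.2, fun c hc hc' => ?_⟩
    exact (hm' ⟨c.2, hzy.ge_of_gt hc⟩).not_gt hc'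

theorem Cardinal.mk_eq_aleph_one_iff {α : Type*} {s : Set α} :
    #s = ℵ₁ ↔ #s ≤ ℵ₁ ∧ ¬ s.Countable := by
  rw [← Cardinal.le_aleph0_iff_set_countable, not_le,
    ← Cardinal.aleph_one_le_iff]
  exact le_antisymm_iff

universe u

theorem jumpKernel_nonempty {K : Type*} [LinearOrder K] [TopologicalSpace K]
    [OrderTopology K] [TopologicalSpace.SeparableSpace K] (hK : ℵ₀ < topologicalWeight K) :
    (jumpKernel K).Nonempty := by
  by_contra hne
  rw [not_nonempty_iff_eq_empty] at hne
  obtain ⟨V, hV, hVc, -⟩ := exists_compl_jumpKernel_subset K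
  rw [hne, compl_empty, univ_subset_iff] at hV
  rw [hV, inter_univ] at hVc
  exact (weight_le_aleph0_of_countable_jumps hVc).not_gt hK

theorem isCardinalDense_jumps_jumpKernel {K : Type*} [LinearOrder K] [TopologicalSpace K]
    [OrderTopology K] [CompactSpace K] [TopologicalSpace.SeparableSpace K]
    (hK : topologicalWeight K = ℵ₁) : IsCardinalDense ℵ₁ (jumps (jumpKernel K)) :=
  fun _ hU hne => Cardinal.mk_eq_aleph_one_iff.2
    ⟨(Cardinal.mk_le_mk_of_subset inter_subset_right).trans ((mk_jumps_le_weight _).trans hK.le),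
      not_countable_inter_jumps_jumpKernel hU hne⟩

/-! ### The kernel as a line of cuts -/

theorem IsCardinalDense.not_countable {X : Type*} [TopologicalSpace X] {A : Set X}
    (hA : IsCardinalDense ℵ₁ A) {U : Set X} (hU : IsOpen U) (hne : U.Nonempty) :
    ¬ (U ∩ A).Countable :=
  (Cardinal.mk_eq_aleph_one_iff.1 (hA U hU hne)).2

/-- With `c` the successor of `b`, the open interval from `a` to `c` is nonempty and exceeds `Ioo a
b` only by `b`. -/
theorem not_countable_Ioo_inter_jumps {H : Type*} [LinearOrder H] [TopologicalSpace H]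
    [OrderTopology H] (hJ : IsCardinalDense ℵ₁ (jumps H)) {a b : H} (hab : a < b)
    (hb : b ∈ jumps H) : ¬ (Ioo a b ∩ jumps H).Countable := by
  intro h
  obtain ⟨c, hbc⟩ := hb
  refine hJ.not_countable (isOpen_Ioo (a := a) (b := c)) ⟨b, hab, hbc.lt⟩ ?_
  refine (h.union (countable_singleton b)).mono ?_
  rintro z ⟨hz, hzJ⟩
  rcases lt_trichotomy z b with h' | h' | h'
  · exact .inl ⟨⟨hz.1, h'⟩, hzJ⟩
  · exact .inr h'
  · exact (hbc.2 h' hz.2).elim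

theorem exists_between_jumps {H : Type*} [LinearOrder H] [TopologicalSpace H]
    [OrderTopology H] (hJ : IsCardinalDense ℵ₁ (jumps H)) {a b : H} (hab : a < b)
    (hb : b ∈ jumps H) : ∃ c ∈ jumps H, a < c ∧ c < b := by
  by_contra! h
  refine not_countable_Ioo_inter_jumps hJ hab hb ?_
  convert countable_empty
  rw [← not_nonempty_iff_eq_empty]
  rintro ⟨c, hc, hcJ⟩
  exact (h c hcJ hc.1).not_gt hc.2

/-- A dense set of `K` may miss `H`, so one jump is chosen between each pair from `D` that has a
jump between its members. -/
theorem exists_countable_order_dense_jumps {K : Type*} [LinearOrder K] [TopologicalSpace K]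
    [OrderTopology K] [TopologicalSpace.SeparableSpace K] {H : Set K} [OrderTopology H]
    (hJ : IsCardinalDense ℵ₁ (jumps H)) :
    ∃ Q : Set (jumps H), Q.Countable ∧ ∀ a b : jumps H, a < b → ∃ q ∈ Q, a < q ∧ q < b := by
  obtain ⟨D, hD, hD'⟩ := TopologicalSpace.exists_countable_dense K
  let P : Set (K × K) := {p | p ∈ D ×ˢ D ∧ ∃ q : jumps H, p.1 < q ∧ (q : K) < p.2}
  have hP : P.Countable := (hD.prod hD).mono fun p hp => hp.1
  have := hP.to_subtype
  have hq : ∀ p : P, ∃ q : jumps H, p.1.1 < q ∧ (q : K) < p.1.2 := fun p => p.2.2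
  choose q hq hq' using hq
  refine ⟨range q, countable_range q, fun a b hab => ?_⟩
  obtain ⟨h, hh, hah, hhb⟩ := exists_between_jumps hJ (show (a : H) < b from hab) b.2
  obtain ⟨h₁, -, h1, h2⟩ := exists_between_jumps hJ hah hh
  obtain ⟨h₂, -, h3, h4⟩ := exists_between_jumps hJ hhb b.2
  obtain ⟨d, hd, hdD⟩ := hD'.inter_open_nonempty (Ioo ((a : H) : K) h) isOpen_Ioo ⟨h₁, h1, h2⟩
  obtain ⟨d', hd', hdD'⟩ := hD'.inter_open_nonempty (Ioo (h : K) (b : H)) isOpen_Ioo ⟨h₂, h3, h4⟩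
  let p : P := ⟨(d, d'), ⟨hdD, hdD'⟩, ⟨h, hh⟩, hd.2, hd'.1⟩
  exact ⟨q p, mem_range_self p, hd.1.trans (hq p), (hq' p).trans hd'.2⟩

/-- Linear orders with a countable order-dense subset all of whose intervals have cardinality `ℵ₁`
are isomorphic to `ℵ₁`-dense sets of reals. -/
theorem exists_orderIso_real {A : Type u} [LinearOrder A] [Nonempty A] [NoMinOrder A]
    [NoMaxOrder A] {Q : Set A} (hQ : Q.Countable) (hQ' : ∀ a b, a < b → ∃ q ∈ Q, a < q ∧ q < b)
    (hunc : ∀ a b : A, a < b → ¬ (Ioo a b).Countable) (hcard : #A ≤ ℵ₁) :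
    ∃ B : Set ℝ, IsCardinalDense ℵ₁ B ∧ Nonempty (A ≃o B) := by
  have := hQ.to_subtype
  have hlt : ∀ a : A, ∃ q : Q, (q : A) < a := fun a => by
    obtain ⟨b, hb⟩ := exists_lt a
    obtain ⟨q, hq, -, h⟩ := hQ' b a hb
    exact ⟨⟨q, hq⟩, h⟩
  have hgt : ∀ a : A, ∃ q : Q, a < (q : A) := fun a => by
    obtain ⟨b, hb⟩ := exists_gt a
    obtain ⟨q, hq, h, -⟩ := hQ' a b hb
    exact ⟨⟨q, hq⟩, h⟩
  have : Nonempty Q := (hlt (Classical.arbitrary A)).nonempty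
  have : NoMinOrder Q := ⟨fun a => hlt a⟩
  have : NoMaxOrder Q := ⟨fun a => hgt a⟩
  have : DenselyOrdered Q := ⟨fun a b hab => by
    obtain ⟨q, hq, h1, h2⟩ := hQ' a b hab
    exact ⟨⟨q, hq⟩, h1, h2⟩⟩
  obtain ⟨e⟩ := Order.iso_of_countable_dense Q ℚ
  -- With `Q` identified with ℚ, each `a` is sent to the supremum of the part of `Q` up to `a`.
  let S : A → Set ℝ := fun a => (fun q : Q => (e q : ℝ)) '' {q : Q | (q : A) ≤ a}
  have hSlt : ∀ a, ∀ q : Q, a < (q : A) → ∀ x ∈ S a, x < (e q : ℝ) := by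
    rintro a q haq _ ⟨q', hq', rfl⟩
    exact Rat.cast_lt.2 (e.lt_iff_lt.2 (Subtype.coe_lt_coe.1
      (lt_of_le_of_lt (show (q' : A) ≤ a from hq') haq)))
  have hne : ∀ a, (S a).Nonempty := fun a => by
    obtain ⟨q, hq⟩ := hlt a
    exact ⟨_, q, hq.le, rfl⟩
  have hbdd : ∀ a, BddAbove (S a) := fun a => by
    obtain ⟨q, hq⟩ := hgt a
    exact ⟨_, fun x hx => (hSlt a q hq x hx).le⟩
  let g : A → ℝ := fun a => sSup (S a)
  have hg1 : ∀ a, ∀ q : Q, (q : A) ≤ a → (e q : ℝ) ≤ g a := fun a q hq =>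
    le_csSup (hbdd a) ⟨q, hq, rfl⟩
  have hg2 : ∀ a, ∀ q : Q, a < (q : A) → g a ≤ e q := fun a q hq =>
    csSup_le (hne a) fun x hx => (hSlt a q hq x hx).le
  have hmono : StrictMono g := fun a b hab => by
    obtain ⟨q, hq, h1, h2⟩ := hQ' a b hab
    obtain ⟨q', hq', h3, h4⟩ := hQ' q b h2
    -- Suprema compare only weakly with elements of `Q`, so strictness comes from a second such
    -- element.
    calc g a ≤ e ⟨q, hq⟩ := hg2 a ⟨q, hq⟩ h1
      _ < e ⟨q', hq'⟩ := Rat.cast_lt.2 (e.lt_iff_lt.2 h3)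
      _ ≤ g b := hg1 b ⟨q', hq'⟩ h4.le
  refine ⟨range g, fun U hU hUne => Cardinal.mk_eq_aleph_one_iff.2 ⟨?_, ?_⟩,
    ⟨hmono.orderIso g⟩⟩
  · have h1 : #(range g) ≤ ℵ₁ := by
      have h2 := Cardinal.mk_range_le_lift (f := g)
      have h3 := Cardinal.lift_le.{0}.2 hcard
      rw [← Cardinal.lift_le.{u}]
      simpa using h2.trans h3
    exact (Cardinal.mk_le_mk_of_subset inter_subset_right).trans h1
  · intro hcount
    obtain ⟨x, hx⟩ := hUne
    obtain ⟨l, r, hlr, hsub⟩ := mem_nhds_iff_exists_Ioo_subset.1 (hU.mem_nhds hx)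
    obtain ⟨p, hp, hp'⟩ := exists_rat_btwn (hlr.1.trans hlr.2)
    obtain ⟨p', hp1, hp2⟩ := exists_rat_btwn hp'
    have hlt : (e.symm p : A) < e.symm p' := e.symm.lt_iff_lt.2 (Rat.cast_lt.1 hp1)
    refine hunc _ _ hlt ((hcount.preimage_of_injOn (f := g) hmono.injective.injOn).mono ?_)
    rintro a ⟨ha, ha'⟩
    refine ⟨hsub ⟨?_, ?_⟩, mem_range_self a⟩
    · have := hg1 a (e.symm p) ha.le
      rw [e.apply_symm_apply] at this
      exact hp.trans_le this
    · have := hg2 a (e.symm p') ha'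
      rw [e.apply_symm_apply] at this
      exact this.trans_lt hp2

/-- A compact line with enough jumps is the line of cuts of its set of jumps. -/
theorem exists_orderIso_lowerSet_jumps {H : Type*} [LinearOrder H] [TopologicalSpace H]
    [OrderTopology H] [CompactSpace H] [Nonempty H] (hJ : IsCardinalDense ℵ₁ (jumps H)) :
    Nonempty (H ≃o LowerSet (jumps H)) := by
  let Θ : H → LowerSet (jumps H) := fun x => ⟨{a | (a : H) < x}, fun a b hba ha =>
    lt_of_le_of_lt (show (b : H) ≤ a from hba) ha⟩
  have hmono : StrictMono Θ := by
    intro x y hxy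
    have : ∃ a ∈ jumps H, x ≤ a ∧ a < y := by
      by_cases hne : (Ioo x y).Nonempty
      · by_contra! hcon
        refine hJ.not_countable isOpen_Ioo hne ?_
        convert countable_empty
        rw [← not_nonempty_iff_eq_empty]
        rintro ⟨c, hc, hcJ⟩
        exact (hcon c hcJ hc.1.le).not_gt hc.2
      · exact ⟨x, ⟨y, hxy, fun z h1 h2 => hne ⟨z, h1, h2⟩⟩, le_rfl, hxy⟩
    obtain ⟨a, ha, h1, h2⟩ := this
    refine lt_of_le_not_ge (fun b hb => ?_) fun hle => ?_
    · exact lt_trans (show (b : H) < x from hb) hxy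
    · exact (show a < x from hle (show (⟨a, ha⟩ : jumps H) ∈ Θ y from h2)).not_ge h1
  refine ⟨hmono.orderIsoOfSurjective Θ fun Λ => ?_⟩
  rcases (Λ : Set (jumps H)).eq_empty_or_nonempty with hΛ | hΛ
  · obtain ⟨m, -, hm⟩ := (isCompact_univ (X := H)).exists_isLeast univ_nonempty
    refine ⟨m, SetLike.coe_injective ?_⟩
    rw [hΛ, eq_empty_iff_forall_notMem]
    exact fun a ha => (hm (mem_univ (a : H))).not_gt ha
  · let T : Set H := Subtype.val '' (Λ : Set (jumps H))
    obtain ⟨s, -, hs⟩ := (isClosed_closure (s := T)).isCompact.exists_isLUB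
      (hΛ.image _).closure
    replace hs : IsLUB T s := by rwa [IsLUB, upperBounds_closure] at hs
    -- The cut is given by its supremum `s`, unless `s` belongs to it. Then `s` is a jump, and its
    -- successor gives the cut.
    by_cases hsT : s ∈ T
    · obtain ⟨⟨s, hsJ⟩, hsΛ, rfl⟩ := hsT
      obtain ⟨t, hst⟩ := id hsJ
      refine ⟨t, SetLike.coe_injective (Set.ext fun a => ⟨fun ha => ?_, fun ha => ?_⟩)⟩
      · exact Λ.lower (show a ≤ ⟨s, hsJ⟩ from hst.le_of_lt ha) hsΛ
      · exact lt_of_le_of_lt (hs.1 ⟨a, ha, rfl⟩) hst.lt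
    · refine ⟨s, SetLike.coe_injective (Set.ext fun a => ⟨fun ha => ?_, fun ha => ?_⟩)⟩
      · obtain ⟨_, ⟨b, hb, rfl⟩, hab, -⟩ := hs.exists_between ha
        exact Λ.lower (show a ≤ b from hab.le) hb
      · exact lt_of_le_of_ne (hs.1 ⟨a, ha, rfl⟩) fun h => hsT ⟨a, ha, h⟩

/-- The jump kernel of a separable compact line of weight `ℵ₁` is the line of cuts of an `ℵ₁`-dense
set of reals. -/
theorem exists_orderIso_jumpKernel {K : Type*} [LinearOrder K] [TopologicalSpace K]
    [OrderTopology K] [CompactSpace K] [TopologicalSpace.SeparableSpace K]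
    (hK : topologicalWeight K = ℵ₁) :
    ∃ A : Set ℝ, IsCardinalDense ℵ₁ A ∧ Nonempty (jumpKernel K ≃o LowerSet A) := by
  have hJ := isCardinalDense_jumps_jumpKernel hK
  have hcl := isClosed_jumpKernel K
  have := orderTopology_of_isClosed hcl
  have := isCompact_iff_compactSpace.1 hcl.isCompact
  have hne := (jumpKernel_nonempty (hK ▸ Cardinal.aleph0_lt_aleph_one)).to_subtype
  set H := jumpKernel K
  have hex : ∀ U : Set H, IsOpen U → U.Nonempty → ∃ a : jumps H, (a : H) ∈ U := fun U hU hne => by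
    obtain ⟨a, ha, haJ⟩ := (hJ.dense (Cardinal.aleph_pos 1).ne').inter_open_nonempty U hU hne
    exact ⟨⟨a, haJ⟩, ha⟩
  have : Nonempty (jumps H) := (hex univ isOpen_univ univ_nonempty).nonempty
  have : NoMaxOrder (jumps H) := ⟨fun a => by
    obtain ⟨y, hy⟩ := a.2
    exact hex _ isOpen_Ioi ⟨y, hy.lt⟩⟩
  have : NoMinOrder (jumps H) := ⟨fun a => by
    obtain ⟨y, hy⟩ := a.2
    by_contra! hcon
    -- Were `a` the least jump, it would be the only jump below its successor `y`.
    refine hJ.not_countable (isOpen_Iio (a := y)) ⟨a, hy.lt⟩ ((countable_singleton (a : H)).mono ?_)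
    rintro z ⟨hz, hzJ⟩
    exact (hy.le_of_lt hz).antisymm (hcon ⟨z, hzJ⟩)⟩
  obtain ⟨Q, hQ, hQ'⟩ := exists_countable_order_dense_jumps hJ
  obtain ⟨B, hB, ⟨e⟩⟩ := exists_orderIso_real hQ hQ'
    (fun a b hab h => not_countable_Ioo_inter_jumps hJ (show (a : H) < b from hab) b.2 <|
      (h.image Subtype.val).mono (by
        rintro z ⟨hz, hzJ⟩
        exact ⟨⟨z, hzJ⟩, hz, rfl⟩)) hJ.mk_eq.le
  obtain ⟨φ⟩ := exists_orderIso_lowerSet_jumps hJ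
  exact ⟨B, hB, ⟨φ.trans (LowerSet.map e)⟩⟩

/-! ### Functions vanishing on the kernel -/

/-- The function is the running maximum of a Urysohn function, its supremum over `Iic x`. Writing
the points of `Iic x` as `min x y` keeps the compact index set independent of `x`, which gives
continuity. -/
theorem exists_monotone_urysohn {K : Type*} [LinearOrder K] [TopologicalSpace K]
    [OrderTopology K] [CompactSpace K] {p q : K} (hpq : p < q) :
    ∃ h : C(K, ℝ), Monotone h ∧ (∀ x, h x ∈ Icc (0 : ℝ) 1) ∧ (∀ x ≤ p, h x = 0) ∧
      ∀ x, q ≤ x → h x = 1 := by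
  obtain ⟨u, h0, h1, hu⟩ := exists_continuous_zero_one_of_isClosed (isClosed_Iic (a := p))
    (isClosed_Ici (a := q)) (disjoint_left.2 fun x hx hx' =>
      (lt_of_le_of_lt (show x ≤ p from hx) hpq).not_ge hx')
  let F : K → K → ℝ := fun x y => u (min x y)
  have hF : Continuous fun x => sSup (F x '' univ) :=
    isCompact_univ.continuous_sSup (f := F) (by
      simp only [F, Function.HasUncurry.uncurry, id]
      fun_prop)
  have hne : ∀ x, (F x '' univ).Nonempty := fun x => ⟨_, x, trivial, rfl⟩
  have hbdd : ∀ x, BddAbove (F x '' univ) := fun x => ⟨1, by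
    rintro _ ⟨y, -, rfl⟩
    exact (hu _).2⟩
  have hmem : ∀ x, sSup (F x '' univ) ∈ Icc (0 : ℝ) 1 := fun x =>
    ⟨(hu (min x x)).1.trans (le_csSup (hbdd x) ⟨x, trivial, rfl⟩), csSup_le (hne x) (by
      rintro _ ⟨y, -, rfl⟩
      exact (hu _).2)⟩
  refine ⟨⟨_, hF⟩, fun x x' hxx' => ?_, hmem, fun x hx => ?_, fun x hx => ?_⟩
  · refine csSup_le_csSup (hbdd x') (hne x) ?_
    rintro _ ⟨y, -, rfl⟩
    refine ⟨min x y, trivial, ?_⟩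
    simp only [F, ← min_assoc, min_eq_right hxx']
  · refine le_antisymm (csSup_le (hne x) ?_) (hmem x).1
    rintro _ ⟨y, -, rfl⟩
    exact (h0 (show min x y ≤ p from (min_le_left _ _).trans hx)).le
  · refine le_antisymm (hmem x).2 (le_csSup (hbdd x) ⟨x, trivial, ?_⟩)
    exact h1 (show q ≤ min x x by rwa [min_self])

/-- A compact line has a continuous map to `[0, 1]` which is injective where there are only
countably many jumps. -/
theorem exists_continuous_separating {K : Type*} [LinearOrder K] [TopologicalSpace K]
    [OrderTopology K] [CompactSpace K] [TopologicalSpace.SeparableSpace K] :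
    ∃ F : C(K, Icc (0 : ℝ) 1), ∀ x y, x ≠ y → F x = F y → x ∈ jumpKernel K ∧ y ∈ jumpKernel K := by
  obtain ⟨D, hD, hD'⟩ := TopologicalSpace.exists_countable_dense K
  obtain ⟨V, hV, hVc, hVs⟩ := exists_compl_jumpKernel_subset K
  have hsucc : ∀ x : (jumps K ∩ V : Set K), ∃ y, (x : K) ⋖ y := fun x => x.2.1
  choose s hs using hsucc
  have := hVc.to_subtype
  let E : Set K := D ∪ (jumps K ∩ V) ∪ range s
  have hE : E.Countable := (hD.union hVc).union (countable_range s)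
  have hEs : ∀ x y, x ⋖ y → x ∈ V → x ∈ E ∧ y ∈ E := fun x y hxy hx =>
    ⟨.inl (.inr ⟨⟨y, hxy⟩, hx⟩), .inr ⟨⟨x, ⟨y, hxy⟩, hx⟩, (hs _).unique_right hxy⟩⟩
  -- `E` supplies a pair between any two points of which one is in `V`: dense points where there is
  -- room, endpoints of jumps in `V` otherwise.
  have hEV : ∀ x y, x < y → x ∈ V ∨ y ∈ V → ∃ p ∈ E, ∃ q ∈ E, x ≤ p ∧ p < q ∧ q ≤ y := by
    intro x y hxy hV
    by_cases hne : (Ioo x y).Nonempty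
    · obtain ⟨d, hd, hdD⟩ := hD'.inter_open_nonempty _ isOpen_Ioo hne
      have hdE : d ∈ E := .inl (.inl hdD)
      rcases hV with hV | hV
      · by_cases hne' : (Ioo x d).Nonempty
        · obtain ⟨d', hd', hdD'⟩ := hD'.inter_open_nonempty _ isOpen_Ioo hne'
          exact ⟨d', .inl (.inl hdD'), d, hdE, hd'.1.le, hd'.2, hd.2.le⟩
        · have := hEs x d ⟨hd.1, fun z h1 h2 => hne' ⟨z, h1, h2⟩⟩ hV
          exact ⟨x, this.1, d, hdE, le_rfl, hd.1, hd.2.le⟩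
      · by_cases hne' : (Ioo d y).Nonempty
        · obtain ⟨d', hd', hdD'⟩ := hD'.inter_open_nonempty _ isOpen_Ioo hne'
          exact ⟨d, hdE, d', .inl (.inl hdD'), hd.1.le, hd'.1, hd'.2.le⟩
        · have hc : d ⋖ y := ⟨hd.2, fun z h1 h2 => hne' ⟨z, h1, h2⟩⟩
          have := hEs d y hc ((hVs _ _ hc).2 hV)
          exact ⟨d, hdE, y, this.2, hd.1.le, hd.2, le_rfl⟩
    · have hc : x ⋖ y := ⟨hxy, fun z h1 h2 => hne ⟨z, h1, h2⟩⟩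
      have := hEs x y hc (hV.elim id (hVs _ _ hc).2)
      exact ⟨x, this.1, y, this.2, le_rfl, hxy, le_rfl⟩
  let P : Set (K × K) := {p | p ∈ E ×ˢ E ∧ p.1 < p.2}
  have hP : P.Countable := (hE.prod hE).mono fun p hp => hp.1
  have := hP.to_subtype
  have hh := fun p : P => exists_monotone_urysohn p.2.2
  choose h hmono hmem h0 h1 using hh
  let := Encodable.ofCountable P
  obtain ⟨w, hw, c, hc, hc1⟩ := posSumOfEncodable one_pos P
  have hle : ∀ p x, w p * h p x ≤ w p := fun p x =>
    mul_le_of_le_one_right (hw p).le (hmem p x).2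
  have h0le : ∀ p x, 0 ≤ w p * h p x := fun p x => mul_nonneg (hw p).le (hmem p x).1
  have hsum : ∀ x, Summable fun p => w p * h p x := fun x =>
    hc.summable.of_nonneg_of_le (fun p => h0le p x) fun p => hle p x
  -- All summands are monotone, so one summand that separates `x` from `y` makes the sum strictly
  -- increase.
  let F : K → ℝ := fun x => ∑' p, w p * h p x
  have hF : Continuous F := by
    refine continuous_tsum (fun p => by fun_prop) hc.summable fun p x => ?_
    rw [Real.norm_of_nonneg (h0le p x)]
    exact hle p x
  have hF01 : ∀ x, F x ∈ Icc (0 : ℝ) 1 := fun x =>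
    ⟨tsum_nonneg fun p => h0le p x,
      ((hsum x).tsum_le_tsum (fun p => hle p x) hc.summable).trans (hc.tsum_eq ▸ hc1)⟩
  have hlt : ∀ x y, x < y → x ∈ V ∨ y ∈ V → F x < F y := by
    intro x y hxy hV
    obtain ⟨p, hp, q, hq, h2, h3, h4⟩ := hEV x y hxy hV
    refine (hsum x).tsum_lt_tsum (i := ⟨(p, q), ⟨hp, hq⟩, h3⟩)
      (fun i => mul_le_mul_of_nonneg_left (hmono i hxy.le) (hw i).le) ?_ (hsum y)
    rw [h0 _ _ h2, h1 _ _ h4, mul_zero, mul_one]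
    exact hw _
  refine ⟨⟨fun x => ⟨F x, hF01 x⟩, by fun_prop⟩, fun x y hne hxy => ?_⟩
  have hxy : F x = F y := congrArg Subtype.val hxy
  have hV' : ¬ (x ∈ V ∨ y ∈ V) := fun hV => by
    rcases lt_or_gt_of_ne hne with h | h
    · exact (hlt x y h hV).ne hxy
    · exact (hlt y x h hV.symm).ne hxy.symm
  push Not at hV'
  exact ⟨not_not.1 fun h => hV'.1 (hV h), not_not.1 fun h => hV'.2 (hV h)⟩

/-- The restriction of continuous functions to a subset. -/
noncomputable def restrictCLM {K : Type*} [TopologicalSpace K] (H : Set K) :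
    C(K, ℝ) →L[ℝ] C(H, ℝ) :=
  pullbackCLM ⟨Subtype.val, continuous_subtype_val⟩ ℝ

/-- The functions vanishing on a closed set whose complement is separated by a map to `[0, 1]` form
a space complemented in `C([0, 1])`. -/
theorem isComplementedIn_ker_restrictCLM {K : Type*} [LinearOrder K] [TopologicalSpace K]
    [OrderTopology K] [CompactSpace K] {H : Set K} (hH : IsClosed H) (hne : H.Nonempty)
    (F : C(K, Icc (0 : ℝ) 1)) (hF : ∀ x y, x ≠ y → F x = F y → x ∈ H ∧ y ∈ H) :
    IsComplementedIn (restrictCLM H).ker C(Icc (0 : ℝ) 1, ℝ) := by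
  have : Nonempty K := hne.nonempty
  have hcl : IsClosed (range F) := (isCompact_range F.continuous).isClosed
  obtain ⟨E₁, hE₁⟩ := hcl.exists_extensionCLM (range_nonempty F)
  obtain ⟨E, hE⟩ := hH.exists_extensionCLM hne
  have := isCompact_iff_compactSpace.1 hH.isCompact
  have := isCompact_iff_compactSpace.1 hcl.isCompact
  let ψ : C(K, range F) := ⟨rangeFactorization F, by fun_prop⟩
  have hψ : IsQuotientMap ψ := IsQuotientMap.of_surjective_continuous
    rangeFactorization_surjective ψ.continuous
  have hfac : ∀ f : (restrictCLM H).ker, ∀ x y, ψ x = ψ y → f.1 x = f.1 y := by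
    intro f x y hxy
    by_cases h : x = y
    · rw [h]
    · obtain ⟨hx, hy⟩ := hF x y h (congrArg Subtype.val hxy)
      have hf : restrictCLM H f.1 = 0 := f.2
      have h1 : f.1 x = 0 := DFunLike.congr_fun hf (⟨x, hx⟩ : H)
      have h2 : f.1 y = 0 := DFunLike.congr_fun hf (⟨y, hy⟩ : H)
      rw [h1, h2]
  let L : (restrictCLM H).ker → C(range F, ℝ) := fun f => hψ.lift f.1 (hfac f)
  have hL : ∀ f x, L f (ψ x) = f.1 x := fun f x =>
    DFunLike.congr_fun (hψ.lift_comp f.1 (hfac f)) x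
  have hLu : ∀ (g g' : C(range F, ℝ)), (∀ x, g (ψ x) = g' (ψ x)) → g = g' := by
    intro g g' h
    ext z
    obtain ⟨x, rfl⟩ := hψ.surjective z
    exact h x
  let i : (restrictCLM H).ker →L[ℝ] C(range F, ℝ) := LinearMap.mkContinuous
    { toFun := L
      map_add' := fun f g => hLu _ _ fun x => by
        rw [ContinuousMap.add_apply, hL, hL, hL]; rfl
      map_smul' := fun c f => hLu _ _ fun x => by
        rw [RingHom.id_apply, ContinuousMap.smul_apply, hL, hL]; rfl } 1 fun f => by
      refine (ContinuousMap.norm_le _ (by positivity)).2 fun z => ?_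
      obtain ⟨x, rfl⟩ := hψ.surjective z
      change ‖L f (ψ x)‖ ≤ _
      rw [hL, one_mul]
      exact f.1.norm_coe_le_norm x
  -- A function pulled back along `F` need not vanish on `H`. Subtracting the extension of its
  -- restriction projects it onto the kernel.
  let R : C(K, ℝ) →L[ℝ] (restrictCLM H).ker :=
    (ContinuousLinearMap.id ℝ _ - E.comp (restrictCLM H)).codRestrict _ fun f => by
      ext x
      have := hE (restrictCLM H f) x
      change f x - E (restrictCLM H f) x = 0
      rw [this]
      exact sub_self _
  have hR : ∀ f : (restrictCLM H).ker, R f.1 = f := fun f => by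
    have hf : restrictCLM H f.1 = 0 := f.2
    refine Subtype.ext ?_
    change f.1 - E (restrictCLM H f.1) = f.1
    rw [hf, map_zero, sub_zero]
  refine ⟨E₁.comp i, R.comp (pullbackCLM F ℝ), fun f => ?_⟩
  have h : pullbackCLM F ℝ (E₁ (i f)) = f.1 := by
    ext x
    exact (hE₁ (i f) (ψ x)).trans (hL f x)
  change R (pullbackCLM F ℝ (E₁ (i f))) = f
  rw [h, hR]

/-! ### Assembling the isomorphism -/

/-- C(K) splits into C of the jump kernel, a copy of C(`LowerSet A`), and the functions vanishing on
that kernel, which the first summand absorbs. -/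
theorem exists_equiv_lowerSet (h𝔠 : (ℵ₁ : Cardinal.{0}) < 𝔠) {K : Type*} [LinearOrder K]
    [TopologicalSpace K] [OrderTopology K] [CompactSpace K] [TopologicalSpace.SeparableSpace K]
    (hK : topologicalWeight K = ℵ₁) :
    ∃ A : Set ℝ, IsCardinalDense ℵ₁ A ∧ Nonempty (C(K, ℝ) ≃L[ℝ] C(LowerSet A, ℝ)) := by
  obtain ⟨A, hA, ⟨φ⟩⟩ := exists_orderIso_jumpKernel hK
  have hcl := isClosed_jumpKernel K
  have hne := jumpKernel_nonempty (hK ▸ Cardinal.aleph0_lt_aleph_one)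
  have := orderTopology_of_isClosed hcl
  have := isCompact_iff_compactSpace.1 hcl.isCompact
  obtain ⟨E, hE⟩ := hcl.exists_extensionCLM hne
  obtain ⟨F, hF⟩ := exists_continuous_separating (K := K)
  have hS := isComplementedIn_ker_restrictCLM hcl hne F hF
  have : CompleteSpace (restrictCLM (jumpKernel K)).ker :=
    (restrictCLM (jumpKernel K)).isClosed_ker.completeSpace_coe
  obtain ⟨e⟩ := exists_absorb_lowerSet h𝔠 hA hS
  let d := ContinuousLinearEquiv.equivOfRightInverse (restrictCLM (jumpKernel K)) E
    fun f => by ext x; exact hE f x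
  exact ⟨A, hA, ⟨d.trans <| (ContinuousLinearEquiv.prodComm ℝ _ _).trans <|
    ((ContinuousLinearEquiv.refl ℝ _).prodCongr φ.toHomeomorph.symm.pullbackEquiv).trans e.symm⟩⟩

theorem theorem1p3 (hBA : BaumgartnerAxiom ℵ₁)
    (K : Type*) [LinearOrder K] [TopologicalSpace K] [OrderTopology K]
    [CompactSpace K] [TopologicalSpace.SeparableSpace K]
    (L : Type*) [LinearOrder L] [TopologicalSpace L] [OrderTopology L]
    [CompactSpace L] [TopologicalSpace.SeparableSpace L]
    (hK : topologicalWeight K = ℵ₁) (hL : topologicalWeight L = ℵ₁) :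
    Nonempty (C(K, ℝ) ≃L[ℝ] C(L, ℝ)) := by
  obtain ⟨A, hA, ⟨e⟩⟩ := exists_equiv_lowerSet hBA.aleph_one_lt_continuum hK
  obtain ⟨B, hB, ⟨f⟩⟩ := exists_equiv_lowerSet hBA.aleph_one_lt_continuum hL
  obtain ⟨φ⟩ := hBA A B hA hB
  exact ⟨(e.trans (LowerSet.map φ).toHomeomorph.symm.pullbackEquiv).trans f.symm⟩
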